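/- Let $M$ be a complex manifold of dimension $m$ and let $(M,g,\circ,e,\mathcal E)$ be a Frobenius manifold: $g$ is a holomorphic symmetric non-degenerate bilinear form on the holomorphic tangent bundle $T^{1,0}M$ with flat Levi-Civita connection $\nabla$; $\circ$ is a holomorphic commutative associative product on $T^{1,0}M$ with unit field $e$, such that $g(X\circ Y,Z)=g(X,Y\circ Z)$, $\nabla(\circ)$ is symmetric, and $\nabla e=0$; and $\mathcal E$ is a holomorphic vector field with $\mathcal L_{\mathcal E}(\circ)=\circ$ and $\mathcal L_{\mathcal E}(g)=(2-d)\,g$ for a constant $d\in\mathbb C$. Let $\kappa$ be a $C^\infty$ real structure (fibrewise antilinear involution) on $T^{1,0}M$ such that $h(X,Y):=g(X,\kappa Y)$ is Hermitian. Let $D=D'+\overline\partial$ be the Chern connection of $h$, and set $$C_XY:=-X\circ Y,\qquad C^\dagger_{\overline X}:=\kappa C_X\kappa,\qquad \mathcal U:=\mathcal E\circ,\qquad \mathcal Q:=D_{\mathcal E}-\mathcal L_{\mathcal E}-\tfrac{2-d}{2}\,\mathrm{Id}$$ ($C^\dagger$ is the $h$-adjoint of $C$; $\mathcal Q$ is the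 new supersymmetric index). One says that $(M,g,\circ,e,\mathcal E,\kappa)$ is a CDV-structure if these data form a CV-structure on $T^{1,0}M$, that is, if $D\kappa=0$, $D'g=0$, $D'(C)=0$, $D'\overline\partial+\overline\partial D'=-(C\wedge C^\dagger+C^\dagger\wedge C)$, $D'(\mathcal U)-[C,\mathcal Q]+C=0$, $D'(\mathcal Q)+[C,\kappa\,\mathcal U\kappa]=0$, and $\mathcal Q$ is anti-self-adjoint for $g$ and self-adjoint for $h$. It is a CDV$\oplus$-structure if moreover $h$ is positive definite. Assume that $(M,g,\circ,e,\mathcal E,\kappa)$ is a CDV$\oplus$-structure which is semi-simple, i.e. multiplication by $\mathcal E$ has $m$ pairwise distinct eigenvalues at each point, and that $M$ has canonical coordinates $u=(u^1,\dots,u^m):M\to\mathbb C^m$ (in the étale sense: $u$ restricts to a holomorphic chart near each point) such that, with $e_i:=\partial_{u^i}$, one has $e_i\circ e_j=\delta_{ij}e_i$ and $\mathcal E=\sum_k u^k e_k$. Let $\eta$ be a metric potential, i.e. a holomorphic function on $M$ with $\eta_i:=\partial\eta/\partial u^i=g(e_i,e_i)$ for all $i$. Then the following statements are equivalent: a) $(h(e_i,e_j))_{m\times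 m}=\operatorname{diag}(|\eta_1|,\dots,|\eta_m|)$ on $M$; b) $D'$ is a holomorphic connection, i.e. $D'\overline\partial+\overline\partial D'=0$; c) $\mathcal Q=0$. -/

import Mathlib

open scoped Manifold ContDiff

namespace TTStar

/-- The model space `ℂᵐ` of complex manifolds of dimension `m`. -/
abbrev Cn (m : ℕ) : Type := Fin m → ℂ

/-! ### Calculus on open subsets of `ℂᵐ`

Vector fields of type `(1,0)` (that is, sections of the holomorphic tangent bundle `T^{1,0}`) on an
open subset of `ℂᵐ` are given by their component functions `Y : ℂᵐ → ℂᵐ`,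
`Y = ∑ k, Y^k ∂/∂x^k`. -/

section Calculus

variable {m : ℕ}

/-- The Wirtinger derivative `∂f/∂x^a` of a (real-differentiable) function `f`. -/
noncomputable def wirt (a : Fin m) (f : Cn m → ℂ) (x : Cn m) : ℂ :=
  (1 / 2) * (fderiv ℝ f x (Pi.single a 1) - Complex.I * fderiv ℝ f x (Pi.single a Complex.I))

/-- The conjugate Wirtinger derivative `∂f/∂x̄^a`. -/
noncomputable def wirtBar (a : Fin m) (f : Cn m → ℂ) (x : Cn m) : ℂ :=
  (1 / 2) * (fderiv ℝ f x (Pi.single a 1) + Complex.I * fderiv ℝ f x (Pi.single a Complex.I))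

/-- The coordinate vector field `∂/∂x^a`. -/
def coordField (a : Fin m) : Cn m → Cn m := fun _ => Pi.single a 1

/-- The derivative `X(f) = ∑ a, X^a ∂f/∂x^a` of a function along a `(1,0)` vector field. -/
noncomputable def dirDeriv (X : Cn m → Cn m) (f : Cn m → ℂ) (x : Cn m) : ℂ :=
  ∑ a, X x a * wirt a f x

/-- The Lie bracket `[X, Y]` (the Lie derivative `L_X Y`), for `X` a holomorphic vector field and
`Y` a vector field of type `(1,0)`. -/
noncomputable def lieBr (X Y : Cn m → Cn m) : Cn m → Cn m := fun x k =>
  dirDeriv X (fun y => Y y k) x - dirDeriv Y (fun y => X y k) x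

/-- Christoffel symbols `Γ_{ab}^k` of the Levi-Civita connection of the holomorphic metric with
Gram matrix `G`. -/
noncomputable def leviCivita (G : Cn m → Matrix (Fin m) (Fin m) ℂ) (a b k : Fin m) (x : Cn m) : ℂ :=
  (1 / 2) * ∑ l, (G x)⁻¹ k l *
    (wirt a (fun y => G y b l) x + wirt b (fun y => G y a l) x - wirt l (fun y => G y a b) x)

/-- Connection coefficients `ω_{ai}^k`, `ω = ∂H · H⁻¹`, of the Chern connection of the Hermitian
form with Gram matrix `H i j = h(∂_i, ∂_j)` (linear in the first argument) in the holomorphic frame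
`∂_i = ∂/∂x^i`. -/
noncomputable def chern (H : Cn m → Matrix (Fin m) (Fin m) ℂ) (a i k : Fin m) (x : Cn m) : ℂ :=
  ∑ j, wirt a (fun y => H y i j) x * (H x)⁻¹ j k

/-- The covariant derivative of `Y` along `∂/∂x^a` for the connection with coefficients `Γ`:
the `k`-th component is `∂Y^k/∂x^a + ∑ b, Γ_{ab}^k Y^b`. -/
noncomputable def covDeriv (Γ : Fin m → Fin m → Fin m → Cn m → ℂ) (a : Fin m)
    (Y : Cn m → Cn m) : Cn m → Cn m := fun x k =>
  wirt a (fun y => Y y k) x + ∑ b, Γ a b k x * Y x b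

/-- The derivative of `Y` along `∂/∂x̄^a` for the natural holomorphic structure `∂̄` of `T^{1,0}`. -/
noncomputable def dbar (a : Fin m) (Y : Cn m → Cn m) : Cn m → Cn m := fun x k =>
  wirtBar a (fun y => Y y k) x

end Calculus

/-! ### Charts of a complex manifold -/

section Charts

variable {m : ℕ} {M : Type*} [TopologicalSpace M] [ChartedSpace (Cn m) M]

/-- The holomorphic charts of `M`, all those of the maximal holomorphic atlas. -/
def IsHolChart (φ : OpenPartialHomeomorph M (Cn m)) : Prop :=
  φ ∈ IsManifold.maximalAtlas 𝓘(ℂ, Cn m) ω M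

/-- The tangent vector of `M` at `φ⁻¹(x)` with components `v` in the chart `φ`. -/
noncomputable def vecAt (φ : OpenPartialHomeomorph M (Cn m)) (x : Cn m) (v : Cn m) :
    TangentSpace 𝓘(ℂ, Cn m) (φ.symm x) :=
  mfderiv 𝓘(ℂ, Cn m) 𝓘(ℂ, Cn m) φ.symm x v

/-- The components in the chart `φ` of a tangent vector of `M` at `φ⁻¹(x)`. -/
noncomputable def compAt (φ : OpenPartialHomeomorph M (Cn m)) (x : Cn m)
    (w : TangentSpace 𝓘(ℂ, Cn m) (φ.symm x)) : Cn m :=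
  mfderiv 𝓘(ℂ, Cn m) 𝓘(ℂ, Cn m) φ (φ.symm x) w

/-- `Y` is a holomorphic vector field on the domain of the chart `φ`. -/
def HolField (φ : OpenPartialHomeomorph M (Cn m)) (Y : Cn m → Cn m) : Prop :=
  DifferentiableOn ℂ Y φ.target

/-- `Y` is a `C^∞` vector field of type `(1,0)` on the domain of the chart `φ`. -/
def SmoothField (φ : OpenPartialHomeomorph M (Cn m)) (Y : Cn m → Cn m) : Prop :=
  ContDiffOn ℝ ∞ Y φ.target

end Charts

/-! ### Frobenius manifolds -/

/-- The data `(g, ∘, e, E, d)` underlying a Frobenius manifold: tensor fields on the holomorphic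
tangent bundle. The conditions are in `FrobeniusData.IsFrobenius`. -/
structure FrobeniusData (m : ℕ) (M : Type*) [TopologicalSpace M] [ChartedSpace (Cn m) M] where
  /-- the metric, a complex bilinear form -/
  g : ∀ p : M, TangentSpace 𝓘(ℂ, Cn m) p →ₗ[ℂ] TangentSpace 𝓘(ℂ, Cn m) p →ₗ[ℂ] ℂ
  /-- the product `∘` -/
  mul : ∀ p : M, TangentSpace 𝓘(ℂ, Cn m) p →ₗ[ℂ] TangentSpace 𝓘(ℂ, Cn m) p →ₗ[ℂ]
    TangentSpace 𝓘(ℂ, Cn m) p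
  /-- the unit field -/
  e : ∀ p : M, TangentSpace 𝓘(ℂ, Cn m) p
  /-- the Euler field -/
  E : ∀ p : M, TangentSpace 𝓘(ℂ, Cn m) p
  /-- the constant `d` -/
  d : ℂ

namespace FrobeniusData

variable {m : ℕ} {M : Type*} [TopologicalSpace M] [ChartedSpace (Cn m) M]
  (F : FrobeniusData m M) (φ : OpenPartialHomeomorph M (Cn m))

/-- `g(Y, Z)` in the chart `φ`. -/
noncomputable def locG (Y Z : Cn m → Cn m) : Cn m → ℂ := fun x =>
  F.g (φ.symm x) (vecAt φ x (Y x)) (vecAt φ x (Z x))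

/-- `Y ∘ Z` in the chart `φ`. -/
noncomputable def locMul (Y Z : Cn m → Cn m) : Cn m → Cn m := fun x =>
  compAt φ x (F.mul (φ.symm x) (vecAt φ x (Y x)) (vecAt φ x (Z x)))

/-- The unit field in the chart `φ`. -/
noncomputable def locUnit : Cn m → Cn m := fun x => compAt φ x (F.e (φ.symm x))

/-- The Euler field in the chart `φ`. -/
noncomputable def locE : Cn m → Cn m := fun x => compAt φ x (F.E (φ.symm x))

/-- The Levi-Civita covariant derivative `∇_{∂/∂x^a}` of `g` in the chart `φ`. -/
noncomputable def nabla (a : Fin m) (Y : Cn m → Cn m) : Cn m → Cn m :=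
  covDeriv (leviCivita fun x => Matrix.of fun i j => F.locG φ (coordField i) (coordField j) x) a Y

/-- `(M, g, ∘, e, E)` is a Frobenius manifold with constant `d`. Differential conditions are
tensorial; they are stated in the holomorphic charts `φ`, with forms evaluated on coordinate
fields. -/
structure IsFrobenius : Prop where
  g_symm : ∀ (p : M) (v w : TangentSpace 𝓘(ℂ, Cn m) p), F.g p v w = F.g p w v
  g_nondeg : ∀ (p : M) (v : TangentSpace 𝓘(ℂ, Cn m) p), (∀ w, F.g p v w = 0) → v = 0
  mul_comm : ∀ (p : M) (v w : TangentSpace 𝓘(ℂ, Cn m) p), F.mul p v w = F.mul p w v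
  mul_assoc : ∀ (p : M) (v w z : TangentSpace 𝓘(ℂ, Cn m) p),
    F.mul p (F.mul p v w) z = F.mul p v (F.mul p w z)
  unit_mul : ∀ (p : M) (v : TangentSpace 𝓘(ℂ, Cn m) p), F.mul p (F.e p) v = v
  /-- `g(v ∘ w, z) = g(v, w ∘ z)` -/
  g_mul : ∀ (p : M) (v w z : TangentSpace 𝓘(ℂ, Cn m) p),
    F.g p (F.mul p v w) z = F.g p v (F.mul p w z)
  g_hol : ∀ φ, IsHolChart φ → ∀ Y Z, HolField φ Y → HolField φ Z →
    DifferentiableOn ℂ (F.locG φ Y Z) φ.target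
  mul_hol : ∀ φ, IsHolChart φ → ∀ Y Z, HolField φ Y → HolField φ Z →
    HolField φ (F.locMul φ Y Z)
  e_hol : ∀ φ, IsHolChart φ → HolField φ (F.locUnit φ)
  E_hol : ∀ φ, IsHolChart φ → HolField φ (F.locE φ)
  /-- `∇` is flat -/
  flat : ∀ φ, IsHolChart φ → ∀ (a b : Fin m) Z, HolField φ Z → ∀ x ∈ φ.target,
    F.nabla φ a (F.nabla φ b Z) x = F.nabla φ b (F.nabla φ a Z) x
  /-- potentiality: the `(3,1)`-tensor `∇(∘)` is symmetric -/
  potential : ∀ φ, IsHolChart φ → ∀ (a b : Fin m) Z, HolField φ Z → ∀ x ∈ φ.target,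
    F.nabla φ a (F.locMul φ (coordField b) Z) x - F.locMul φ (coordField b) (F.nabla φ a Z) x
      = F.nabla φ b (F.locMul φ (coordField a) Z) x - F.locMul φ (coordField a) (F.nabla φ b Z) x
  /-- `∇ e = 0` -/
  unit_flat : ∀ φ, IsHolChart φ → ∀ (a : Fin m), ∀ x ∈ φ.target,
    F.nabla φ a (F.locUnit φ) x = 0
  /-- `L_E(∘) = ∘` -/
  lie_mul : ∀ φ, IsHolChart φ → ∀ Y Z, HolField φ Y → HolField φ Z → ∀ x ∈ φ.target,
    lieBr (F.locE φ) (F.locMul φ Y Z) x - F.locMul φ (lieBr (F.locE φ) Y) Z x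
      - F.locMul φ Y (lieBr (F.locE φ) Z) x = F.locMul φ Y Z x
  /-- `L_E(g) = (2 - d) g` -/
  lie_g : ∀ φ, IsHolChart φ → ∀ Y Z, HolField φ Y → HolField φ Z → ∀ x ∈ φ.target,
    dirDeriv (F.locE φ) (F.locG φ Y Z) x - F.locG φ (lieBr (F.locE φ) Y) Z x
      - F.locG φ Y (lieBr (F.locE φ) Z) x = (2 - F.d) * F.locG φ Y Z x

/-- Semi-simplicity: at each point, multiplication by the Euler field has `m = dim M` pairwise
distinct eigenvalues. -/
def IsSemisimple : Prop :=
  ∀ p : M, ∃ μ : Fin m → ℂ, Function.Injective μ ∧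
    ∀ i, Module.End.HasEigenvalue (R := ℂ) (M := TangentSpace 𝓘(ℂ, Cn m) p)
      (F.mul p (F.E p)) (μ i)

end FrobeniusData

/-! ### CDV-structures -/

/-- The data `(g, ∘, e, E, κ)` underlying a CDV-structure: those of a Frobenius manifold and a
fibrewise antilinear map `κ` of the holomorphic tangent bundle. The conditions are in
`CDVData.IsCDV`. -/
structure CDVData (m : ℕ) (M : Type*) [TopologicalSpace M] [ChartedSpace (Cn m) M]
    extends FrobeniusData m M where
  /-- the real structure -/
  κ : ∀ p : M, TangentSpace 𝓘(ℂ, Cn m) p →ₛₗ[starRingEnd ℂ] TangentSpace 𝓘(ℂ, Cn m) p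

namespace CDVData

variable {m : ℕ} {M : Type*} [TopologicalSpace M] [ChartedSpace (Cn m) M]
  (S : CDVData m M) (φ : OpenPartialHomeomorph M (Cn m))

/-- The form `h(v, w) = g(v, κ w)`, linear in `v` and antilinear in `w`. -/
noncomputable def h (p : M) (v w : TangentSpace 𝓘(ℂ, Cn m) p) : ℂ := S.g p v (S.κ p w)

/-- `h(Y, Z)` in the chart `φ`. -/
noncomputable def locH (Y Z : Cn m → Cn m) : Cn m → ℂ := fun x =>
  S.h (φ.symm x) (vecAt φ x (Y x)) (vecAt φ x (Z x))

/-- `κ Y` in the chart `φ`. -/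
noncomputable def locK (Y : Cn m → Cn m) : Cn m → Cn m := fun x =>
  compAt φ x (S.κ (φ.symm x) (vecAt φ x (Y x)))

/-- The derivative `D'_{∂/∂x^a}` of the Chern connection `D = D' + ∂̄` of `h`, in the chart `φ`. -/
noncomputable def chernD (a : Fin m) (Y : Cn m → Cn m) : Cn m → Cn m :=
  covDeriv (chern fun x => Matrix.of fun i j => S.locH φ (coordField i) (coordField j) x) a Y

/-- The derivative `D_E = D'_E` of the Chern connection along the Euler field. -/
noncomputable def chernE (Y : Cn m → Cn m) : Cn m → Cn m := fun x =>
  ∑ a, S.locE φ x a • S.chernD φ a Y x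

/-- The Higgs field `C` (also denoted `Φ`), `C_X Y = - X ∘ Y`, along `X = ∂/∂x^a`. -/
noncomputable def higgs (a : Fin m) (Y : Cn m → Cn m) : Cn m → Cn m := fun x =>
  - S.locMul φ (coordField a) Y x

/-- The adjoint Higgs field `κ C_X κ` along the conjugate of `X = ∂/∂x^a`. It is the adjoint of
`C_X` for `h`, since `C_X` is self-adjoint for `g`. -/
noncomputable def higgsDag (a : Fin m) (Y : Cn m → Cn m) : Cn m → Cn m :=
  S.locK φ (S.higgs φ a (S.locK φ Y))

/-- The endomorphism `U`, multiplication by the Euler field. -/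
noncomputable def opU (Y : Cn m → Cn m) : Cn m → Cn m := S.locMul φ (S.locE φ) Y

/-- The adjoint `κ U κ` of `U` for `h`. -/
noncomputable def opUDag (Y : Cn m → Cn m) : Cn m → Cn m := S.locK φ (S.opU φ (S.locK φ Y))

/-- The new supersymmetric index `Q = D_E - L_E - (2-d)/2 Id`, in the chart `φ`. -/
noncomputable def opQ (Y : Cn m → Cn m) : Cn m → Cn m := fun x =>
  S.chernE φ Y x - lieBr (S.locE φ) Y x - ((2 - S.d) / 2) • Y x

/-- `(M, g, ∘, e, E, κ)` is a CDV-structure: a Frobenius manifold together with a real structure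
`κ` on `T^{1,0}` such that `(T^{1,0}, D, C, κCκ, κ, g, h, U, Q)` is a CV-structure, with
`h = g(·, κ ·)`, `D` the Chern connection of `h`, `C_X Y = - X ∘ Y`, `U = E ∘` and
`Q = D_E - L_E - (2-d)/2 Id`. The remaining conditions of a CV-structure hold by construction
(`D h = 0`, `D''² = 0`, `D'' C = 0`, `C ∧ C = 0`, `[C, U] = 0`, `D'' U = 0`, `C` and `U`
self-adjoint for `g`) or follow by conjugating with `κ`. -/
structure IsCDV : Prop where
  frobenius : S.toFrobeniusData.IsFrobenius
  /-- `κ² = Id` -/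
  κ_invol : ∀ (p : M) (v : TangentSpace 𝓘(ℂ, Cn m) p), S.κ p (S.κ p v) = v
  κ_smooth : ∀ φ, IsHolChart φ → ∀ Y, SmoothField φ Y → SmoothField φ (S.locK φ Y)
  /-- `h` is Hermitian -/
  h_herm : ∀ (p : M) (v w : TangentSpace 𝓘(ℂ, Cn m) p), S.h p v w = starRingEnd ℂ (S.h p w v)
  /-- `D κ = 0`, `(1,0)`-part -/
  dκ : ∀ φ, IsHolChart φ → ∀ (a : Fin m) Y, SmoothField φ Y → ∀ x ∈ φ.target,
    S.chernD φ a (S.locK φ Y) x = S.locK φ (dbar a Y) x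
  /-- `D κ = 0`, `(0,1)`-part -/
  dbarκ : ∀ φ, IsHolChart φ → ∀ (a : Fin m) Y, SmoothField φ Y → ∀ x ∈ φ.target,
    dbar a (S.locK φ Y) x = S.locK φ (S.chernD φ a Y) x
  /-- `D' g = 0` -/
  dg : ∀ φ, IsHolChart φ → ∀ (a : Fin m) Y Z, SmoothField φ Y → SmoothField φ Z → ∀ x ∈ φ.target,
    wirt a (S.locG φ Y Z) x = S.locG φ (S.chernD φ a Y) Z x + S.locG φ Y (S.chernD φ a Z) x
  /-- `D' C = 0` -/
  dC : ∀ φ, IsHolChart φ → ∀ (a b : Fin m) Y, SmoothField φ Y → ∀ x ∈ φ.target,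
    S.chernD φ a (S.higgs φ b Y) x - S.higgs φ b (S.chernD φ a Y) x
      = S.chernD φ b (S.higgs φ a Y) x - S.higgs φ a (S.chernD φ b Y) x
  /-- `D'∂̄ + ∂̄D' + C ∧ C† + C† ∧ C = 0` -/
  ttstar : ∀ φ, IsHolChart φ → ∀ (a b : Fin m) Y, SmoothField φ Y → ∀ x ∈ φ.target,
    (S.chernD φ a (dbar b Y) x - dbar b (S.chernD φ a Y) x)
      + (S.higgs φ a (S.higgsDag φ b Y) x - S.higgsDag φ b (S.higgs φ a Y) x) = 0
  /-- `D'(U) - [C, Q] + C = 0` -/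
  dU : ∀ φ, IsHolChart φ → ∀ (a : Fin m) Y, SmoothField φ Y → ∀ x ∈ φ.target,
    (S.chernD φ a (S.opU φ Y) x - S.opU φ (S.chernD φ a Y) x)
      - (S.higgs φ a (S.opQ φ Y) x - S.opQ φ (S.higgs φ a Y) x) + S.higgs φ a Y x = 0
  /-- `D'(Q) + [C, κUκ] = 0` -/
  dQ : ∀ φ, IsHolChart φ → ∀ (a : Fin m) Y, SmoothField φ Y → ∀ x ∈ φ.target,
    (S.chernD φ a (S.opQ φ Y) x - S.opQ φ (S.chernD φ a Y) x)
      + (S.higgs φ a (S.opUDag φ Y) x - S.opUDag φ (S.higgs φ a Y) x) = 0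
  /-- `Q` is anti-self-adjoint for `g` -/
  Q_g : ∀ φ, IsHolChart φ → ∀ Y Z, SmoothField φ Y → SmoothField φ Z → ∀ x ∈ φ.target,
    S.locG φ (S.opQ φ Y) Z x = - S.locG φ Y (S.opQ φ Z) x
  /-- `Q` is self-adjoint for `h` -/
  Q_h : ∀ φ, IsHolChart φ → ∀ Y Z, SmoothField φ Y → SmoothField φ Z → ∀ x ∈ φ.target,
    S.locH φ (S.opQ φ Y) Z x = S.locH φ Y (S.opQ φ Z) x

/-- A CDV⊕-structure: a CDV-structure whose Hermitian form `h` is positive definite. -/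
structure IsCDVPos : Prop extends S.IsCDV where
  h_pos : ∀ (p : M) (v : TangentSpace 𝓘(ℂ, Cn m) p), v ≠ 0 → 0 < (S.h p v v).re

/-- `D'` is a holomorphic connection: `D'∂̄ + ∂̄D' = 0`. -/
def ChernHolomorphic : Prop :=
  ∀ φ : OpenPartialHomeomorph M (Cn m), IsHolChart φ → ∀ (a b : Fin m) Y, SmoothField φ Y →
    ∀ x ∈ φ.target, S.chernD φ a (dbar b Y) x - dbar b (S.chernD φ a Y) x = 0

/-- The endomorphism `Q` of `T^{1,0}` vanishes. -/
def IndexVanishes : Prop :=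
  ∀ φ : OpenPartialHomeomorph M (Cn m), IsHolChart φ → ∀ Y, SmoothField φ Y →
    ∀ x ∈ φ.target, S.opQ φ Y x = 0

end CDVData

/-! ### Canonical coordinates and the metric potential -/

section Canonical

variable {m : ℕ} {M : Type*} [TopologicalSpace M] [ChartedSpace (Cn m) M]

/-- The vector field `∂/∂u^i` of a system of (étale) coordinates `u : M → ℂᵐ`. -/
noncomputable def frame (u : M → Cn m) (i : Fin m) (p : M) : TangentSpace 𝓘(ℂ, Cn m) p :=
  (mfderiv 𝓘(ℂ, Cn m) 𝓘(ℂ, Cn m) u p).inverse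
    (show TangentSpace 𝓘(ℂ, Cn m) (u p) from (Pi.single i 1 : Cn m))

/-- `u = (u^1, …, u^m)` are canonical coordinates (in the étale sense: `u` is globally defined and
restricts to a chart near each point), normalised by `E = ∑ k, u^k ∂/∂u^k`. -/
structure IsCanonical (F : FrobeniusData m M) (u : M → Cn m) : Prop where
  etale : ∀ p : M, ∃ φ : OpenPartialHomeomorph M (Cn m),
    IsHolChart φ ∧ p ∈ φ.source ∧ Set.EqOn φ u φ.source
  mul_frame : ∀ (p : M) (i j : Fin m),
    F.mul p (frame u i p) (frame u j p) = if i = j then frame u i p else 0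
  euler : ∀ p : M, F.E p = ∑ k, u p k • frame u k p

/-- The derivative `η_i = ∂η/∂u^i` of a function `η` on `M`. -/
noncomputable def potDeriv (u : M → Cn m) (η : M → ℂ) (i : Fin m) (p : M) : ℂ :=
  mfderiv 𝓘(ℂ, Cn m) 𝓘(ℂ, ℂ) η p (frame u i p)

/-- `η` is a metric potential: a holomorphic function with `∂η/∂u^i = g(∂/∂u^i, ∂/∂u^i)`. -/
structure IsMetricPotential (F : FrobeniusData m M) (u : M → Cn m) (η : M → ℂ) : Prop where
  hol : MDifferentiable 𝓘(ℂ, Cn m) 𝓘(ℂ, ℂ) η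
  deriv_eq : ∀ (p : M) (i : Fin m), potDeriv u η i p = F.g p (frame u i p) (frame u i p)

end Canonical

end TTStar

namespace TTStar

/-! ### Semisimple algebras with an antilinear involution -/

section Algebra

variable {m : ℕ} {V : Type*} [AddCommGroup V] [Module ℂ V] {b : Module.Basis (Fin m) ℂ V}
  {mul : V →ₗ[ℂ] V →ₗ[ℂ] V} {g : V →ₗ[ℂ] V →ₗ[ℂ] ℂ} {κ : V →ₛₗ[starRingEnd ℂ] V}

/-! All three conditions are equivalent to one pointwise statement, `KappaDiagonal`: `κ` sends each
idempotent `e_i` to a multiple of itself. Condition a): since `g(e_i, v) = v^i η_i`, the Gram entry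
`h(e_i, e_j)` is `(κ e_j)^i η_i`. Off-diagonal entries thus vanish exactly when `κ` is diagonal, and
then `κ² = 1` and positivity force the diagonal entries to be `|η_i|` (`isDiagIn_iff_gram`).
Condition b): by the tt*-equation `D'` is holomorphic iff every `C_X` commutes with every `κ C_Y κ`.
Diagonal operators commute. Conversely, evaluating the commutation on `e_i` alone gives diagonality,
because `(κ e_i)^i ≠ 0` by positivity (`isDiagIn_of_commute`). Condition c): if `Q = 0`, then `D'(Q)
+ [C, κUκ] = 0` makes `κUκ` commute with all multiplications. So `κ e_i` is an eigenvector of `U`,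
and the distinct eigenvalues make it a multiple of `e_i` (`isDiagIn_of_commute_element`).
Conversely, for diagonal `κ` both `L_E` and `D_E` preserve the lines `ℂ e_i`, so `Q e_i = q e_i`;
anti-self-adjointness of `Q` for `g` gives `q η_i = 0`, hence `q = 0`. -/

theorem repr_mul_of_idempotents (hb : ∀ i j, mul (b i) (b j) = if i = j then b i else 0)
    (v w : V) (j : Fin m) : b.repr (mul v w) j = b.repr v j * b.repr w j := by
  conv_lhs => rw [← b.sum_repr v, ← b.sum_repr w]
  simp only [map_sum, map_smul, LinearMap.sum_apply, LinearMap.smul_apply, hb, Finsupp.finsetSum_apply,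
    Finsupp.smul_apply, smul_eq_mul]
  simp [apply_ite, Finsupp.single_apply, ite_apply, mul_comm]

theorem mul_idempotent (hb : ∀ i j, mul (b i) (b j) = if i = j then b i else 0)
    (i : Fin m) (v : V) : mul (b i) v = b.repr v i • b i := by
  apply b.ext_elem
  intro j
  rw [repr_mul_of_idempotents hb]
  by_cases h : i = j
  · subst h; simp
  · simp [Finsupp.single_eq_of_ne (Ne.symm h)]

theorem metric_idempotents (hb : ∀ i j, mul (b i) (b j) = if i = j then b i else 0)
    (hg : ∀ v w z, g (mul v w) z = g v (mul w z)) {i j : Fin m} (hij : i ≠ j) :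
    g (b i) (b j) = 0 := by
  have := hg (b i) (b i) (b j)
  simpa [hb, hij] using this

theorem metric_idempotent_left (hb : ∀ i j, mul (b i) (b j) = if i = j then b i else 0)
    (hg : ∀ v w z, g (mul v w) z = g v (mul w z)) (i : Fin m) (v : V) :
    g (b i) v = b.repr v i * g (b i) (b i) := by
  conv_lhs => rw [← b.sum_repr v]
  rw [map_sum, Finset.sum_eq_single i]
  · simp
  · intro j _ hj
    simp [metric_idempotents hb hg (Ne.symm hj)]
  · simp

theorem metric_idempotent_ne_zero (hb : ∀ i j, mul (b i) (b j) = if i = j then b i else 0)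
    (hg : ∀ v w z, g (mul v w) z = g v (mul w z)) (hnd : ∀ v, (∀ w, g v w = 0) → v = 0)
    (i : Fin m) : g (b i) (b i) ≠ 0 := by
  intro h
  refine b.ne_zero i (hnd _ fun w => ?_)
  rw [metric_idempotent_left hb hg, h, mul_zero]

/-- The antilinear map `κ` is diagonal in the basis `b`. -/
def IsDiagIn (κ : V →ₛₗ[starRingEnd ℂ] V) (b : Module.Basis (Fin m) ℂ V) : Prop :=
  ∀ i, κ (b i) = b.repr (κ (b i)) i • b i

theorem IsDiagIn.repr_apply (hκ : IsDiagIn κ b) (v : V) (j : Fin m) :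
    b.repr (κ v) j = b.repr (κ (b j)) j * starRingEnd ℂ (b.repr v j) := by
  conv_lhs => rw [← b.sum_repr v]
  rw [map_sum, map_sum, Finset.sum_apply']
  rw [Finset.sum_eq_single j]
  · simp [mul_comm]
  · intro i _ hi
    rw [LinearMap.map_smulₛₗ, hκ i]
    simp [Finsupp.single_eq_of_ne (Ne.symm hi)]
  · simp

/-- In each coordinate the two conjugations cancel, so both sides are the same product of scalars.
-/
theorem IsDiagIn.commute (hκ : IsDiagIn κ b)
    (hb : ∀ i j, mul (b i) (b j) = if i = j then b i else 0) (v w y : V) :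
    mul v (κ (mul w (κ y))) = κ (mul w (κ (mul v y))) := by
  apply b.ext_elem
  intro j
  obtain ⟨k, hk⟩ : ∃ k, ∀ z, b.repr (κ z) j = k * starRingEnd ℂ (b.repr z j) :=
    ⟨_, fun z => hκ.repr_apply z j⟩
  simp only [repr_mul_of_idempotents hb, hk, map_mul, Complex.conj_conj]
  ring

theorem IsDiagIn.ne_zero (hκ : IsDiagIn κ b) (hinv : ∀ v, κ (κ v) = v) (i : Fin m) :
    b.repr (κ (b i)) i ≠ 0 := by
  intro h
  have h0 := hκ i
  rw [h, zero_smul] at h0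
  have := hinv (b i)
  rw [h0, map_zero] at this
  exact b.ne_zero i this.symm

theorem IsDiagIn.norm_eq_one (hκ : IsDiagIn κ b) (hinv : ∀ v, κ (κ v) = v) (i : Fin m) :
    ‖b.repr (κ (b i)) i‖ = 1 := by
  have h := congrArg (fun v => b.repr v i) (hinv (b i))
  simp only [hκ.repr_apply (κ (b i))] at h
  rw [Complex.mul_conj, Module.Basis.repr_self, Finsupp.single_eq_same] at h
  have h' : Complex.normSq (b.repr (κ (b i)) i) = 1 := by exact_mod_cast h
  rw [Complex.normSq_eq_norm_sq] at h'
  exact (pow_eq_one_iff_of_nonneg (norm_nonneg _) two_ne_zero).1 h'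

theorem isDiagIn_iff_gram (hb : ∀ i j, mul (b i) (b j) = if i = j then b i else 0)
    (hg : ∀ v w z, g (mul v w) z = g v (mul w z)) (hnd : ∀ v, (∀ w, g v w = 0) → v = 0)
    (hinv : ∀ v, κ (κ v) = v)
    (hherm : ∀ v w, g v (κ w) = starRingEnd ℂ (g w (κ v)))
    (hpos : ∀ v, v ≠ 0 → 0 < (g v (κ v)).re) :
    IsDiagIn κ b ↔ (Matrix.of fun i j => g (b i) (κ (b j))) =
      Matrix.diagonal fun i => ((‖g (b i) (b i)‖ : ℝ) : ℂ) := by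
  constructor
  · intro hκ
    ext i j
    rw [Matrix.of_apply]
    by_cases hij : i = j
    · subst hij
      rw [Matrix.diagonal_apply_eq]
      have him : (g (b i) (κ (b i))).im = 0 := by
        have := congrArg Complex.im (hherm (b i) (b i))
        rw [Complex.conj_im] at this
        linarith
      have hre := hpos (b i) (b.ne_zero i)
      have hn : ‖g (b i) (κ (b i))‖ = ‖g (b i) (b i)‖ := by
        rw [metric_idempotent_left hb hg, norm_mul, hκ.norm_eq_one hinv, one_mul]
      have hr : g (b i) (κ (b i)) = ((g (b i) (κ (b i))).re : ℂ) :=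
        Complex.ext rfl (by simpa using him)
      rw [← hn]
      conv_rhs => rw [hr, Complex.norm_real, Real.norm_of_nonneg hre.le]
      exact hr
    · rw [Matrix.diagonal_apply_ne _ hij, hκ j, map_smul, metric_idempotents hb hg hij, smul_zero]
  · intro h i
    apply b.ext_elem
    intro j
    by_cases hij : i = j
    · subst hij; simp
    · have h1 := congrFun (congrFun h j) i
      rw [Matrix.of_apply, Matrix.diagonal_apply_ne _ (Ne.symm hij),
        metric_idempotent_left hb hg] at h1
      have := (mul_eq_zero.1 h1).resolve_right (metric_idempotent_ne_zero hb hg hnd j)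
      simp [this, Finsupp.single_eq_of_ne (Ne.symm hij)]

/-- `h(e_i, e_i) = (κ e_i)^i η_i` is positive. This is how positivity of `h` enters both converse
directions. -/
theorem repr_conj_idempotent_ne_zero
    (hb : ∀ i j, mul (b i) (b j) = if i = j then b i else 0)
    (hg : ∀ v w z, g (mul v w) z = g v (mul w z))
    (hpos : ∀ v, v ≠ 0 → 0 < (g v (κ v)).re) (i : Fin m) : b.repr (κ (b i)) i ≠ 0 := by
  intro h
  have := hpos (b i) (b.ne_zero i)
  rw [metric_idempotent_left hb hg, h, zero_mul] at this
  simp at this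

/-- With all three arguments equal to `e_i` and `K = (κ e_i)^i`, the relation reads `K̄ K e_i = K̄ κ
e_i`, and `K ≠ 0` can be cancelled. -/
theorem isDiagIn_of_commute (hb : ∀ i j, mul (b i) (b j) = if i = j then b i else 0)
    (hg : ∀ v w z, g (mul v w) z = g v (mul w z))
    (hpos : ∀ v, v ≠ 0 → 0 < (g v (κ v)).re)
    (hcomm : ∀ v w y, mul v (κ (mul w (κ y))) = κ (mul w (κ (mul v y)))) :
    IsDiagIn κ b := by
  intro i
  have hK := repr_conj_idempotent_ne_zero hb hg hpos i
  have h := hcomm (b i) (b i) (b i)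
  rw [hb i i, if_pos rfl, mul_idempotent hb i (κ (b i)), LinearMap.map_smulₛₗ, map_smul,
    mul_idempotent hb i (κ (b i))] at h
  exact (smul_right_injective V ((map_ne_zero (starRingEnd ℂ)).2 hK) h).symm

/-- An operator commuting with multiplication by `e_i` preserves `ℂ e_i`. Conjugating by `κ`, the
vector `κ e_i` is an eigenvector of multiplication by `E`, whose eigenvalues are the distinct
components of `E`. -/
theorem isDiagIn_of_commute_element (hb : ∀ i j, mul (b i) (b j) = if i = j then b i else 0)
    (hg : ∀ v w z, g (mul v w) z = g v (mul w z))
    (hpos : ∀ v, v ≠ 0 → 0 < (g v (κ v)).re) (hinv : ∀ v, κ (κ v) = v)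
    {E : V} (hE : Function.Injective (b.repr E))
    (hcomm : ∀ v y, mul v (κ (mul E (κ y))) = κ (mul E (κ (mul v y)))) :
    IsDiagIn κ b := by
  intro i
  have hK := repr_conj_idempotent_ne_zero hb hg hpos i
  have h := hcomm (b i) (b i)
  rw [hb i i, if_pos rfl, mul_idempotent hb i] at h
  set l := b.repr (κ (mul E (κ (b i)))) i
  have h2 : mul E (κ (b i)) = starRingEnd ℂ l • κ (b i) := by
    have := congrArg κ h
    rw [hinv, LinearMap.map_smulₛₗ] at this
    exact this.symm
  have h3 : ∀ j, b.repr E j * b.repr (κ (b i)) j = starRingEnd ℂ l * b.repr (κ (b i)) j := by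
    intro j
    rw [← repr_mul_of_idempotents hb, h2]
    simp
  -- The nonzero `i`-th component of `κ e_i` identifies the eigenvalue as `E^i`; any other nonzero
  -- component would repeat it.
  have hl := mul_right_cancel₀ hK (h3 i)
  apply b.ext_elem
  intro j
  by_cases hij : i = j
  · subst hij; simp
  · have h4 : b.repr (κ (b i)) j = 0 := by
      by_contra h5
      exact hij (hE (hl.trans (mul_right_cancel₀ h5 (h3 j)).symm))
    simp [h4, Finsupp.single_eq_of_ne (Ne.symm hij)]

/-- Multiplication by `E` is diagonal in the idempotents, so each `μ i` is a component of `E`.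
Distinct `μ i` use distinct components, and by counting they exhaust them. -/
theorem repr_injective_of_eigenvalues
    (hb : ∀ i j, mul (b i) (b j) = if i = j then b i else 0) {E : V} {μ : Fin m → ℂ}
    (hμ : Function.Injective μ)
    (hev : ∀ i, Module.End.HasEigenvalue (mul E : Module.End ℂ V) (μ i)) :
    Function.Injective (b.repr E) := by
  have h : ∀ i, ∃ j, b.repr E j = μ i := by
    intro i
    obtain ⟨v, hv⟩ := (hev i).exists_hasEigenvector
    have h1 : mul E v = μ i • v := hv.apply_eq_smul
    by_contra! hne
    refine hv.2 (b.ext_elem fun j => ?_)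
    have h2 := repr_mul_of_idempotents hb E v j
    rw [h1, map_smul, Finsupp.smul_apply, smul_eq_mul] at h2
    by_contra h3
    rw [map_zero] at h3
    exact hne j (mul_right_cancel₀ h3 h2).symm
  choose σ hσ using h
  have hσi : Function.Injective σ := fun i j hij => hμ (by rw [← hσ, ← hσ, hij])
  have hσs := Finite.surjective_of_injective hσi
  intro j k hjk
  obtain ⟨i, rfl⟩ := hσs j
  obtain ⟨l, rfl⟩ := hσs k
  rw [hσ, hσ] at hjk
  rw [hμ hjk]

end Algebra

/-! ### Charts and the canonical frame -/

section Charts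

variable {m : ℕ} {M : Type*} [TopologicalSpace M] [ChartedSpace (Cn m) M]
  {φ : OpenPartialHomeomorph M (Cn m)}

theorem IsHolChart.mdifferentiable [IsManifold 𝓘(ℂ, Cn m) ω M] (hφ : IsHolChart φ) :
    φ.MDifferentiable 𝓘(ℂ, Cn m) 𝓘(ℂ, Cn m) :=
  ⟨(contMDiffOn_of_mem_maximalAtlas (n := ω) hφ).mdifferentiableOn (by simp),
    (contMDiffOn_symm_of_mem_maximalAtlas (n := ω) hφ).mdifferentiableOn (by simp)⟩

/-- `vecAt` as a linear map. -/
noncomputable def vecL (φ : OpenPartialHomeomorph M (Cn m)) (x : Cn m) :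
    Cn m →L[ℂ] TangentSpace 𝓘(ℂ, Cn m) (φ.symm x) :=
  mfderiv 𝓘(ℂ, Cn m) 𝓘(ℂ, Cn m) φ.symm x

/-- `compAt` as a linear map. -/
noncomputable def compL (φ : OpenPartialHomeomorph M (Cn m)) (x : Cn m) :
    TangentSpace 𝓘(ℂ, Cn m) (φ.symm x) →L[ℂ] Cn m :=
  mfderiv 𝓘(ℂ, Cn m) 𝓘(ℂ, Cn m) φ (φ.symm x)

/-- The components in the chart `φ` of the canonical frame. -/
noncomputable def locFrame (φ : OpenPartialHomeomorph M (Cn m)) (u : M → Cn m) (i : Fin m) :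
    Cn m → Cn m := fun x => compL φ x (frame u i (φ.symm x))

theorem mfderiv_eq_of_eqOn {ψ : OpenPartialHomeomorph M (Cn m)} {u : M → Cn m}
    (hu : Set.EqOn ψ u ψ.source) {p : M} (hp : p ∈ ψ.source) :
    mfderiv 𝓘(ℂ, Cn m) 𝓘(ℂ, Cn m) u p = mfderiv 𝓘(ℂ, Cn m) 𝓘(ℂ, Cn m) ψ p := by
  have : u =ᶠ[nhds p] ψ := by
    filter_upwards [ψ.open_source.mem_nhds hp] with q hq using (hu hq).symm
  exact this.mfderiv_eq

variable [IsManifold 𝓘(ℂ, Cn m) ω M]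

theorem compL_vecL (hφ : IsHolChart φ) {x : Cn m} (hx : x ∈ φ.target) (v : Cn m) :
    compL φ x (vecL φ x v) = v :=
  DFunLike.congr_fun (hφ.mdifferentiable.comp_symm_deriv hx) v

theorem vecL_compL (hφ : IsHolChart φ) {x : Cn m} (hx : x ∈ φ.target)
    (w : TangentSpace 𝓘(ℂ, Cn m) (φ.symm x)) : vecL φ x (compL φ x w) = w := by
  have h := hφ.mdifferentiable.symm_comp_deriv (φ.map_target hx)
  rw [φ.right_inv hx] at h
  exact DFunLike.congr_fun h w

theorem frame_eq {ψ : OpenPartialHomeomorph M (Cn m)} (hψ : IsHolChart ψ) {u : M → Cn m}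
    (hu : Set.EqOn ψ u ψ.source) {p : M} (hp : p ∈ ψ.source) (i : Fin m) :
    frame u i p = mfderiv 𝓘(ℂ, Cn m) 𝓘(ℂ, Cn m) ψ.symm (ψ p) (Pi.single i 1 : Cn m) := by
  have h1 := hψ.mdifferentiable.symm_comp_deriv hp
  have h2 := hψ.mdifferentiable.comp_symm_deriv (ψ.map_source hp)
  rw [ψ.left_inv hp] at h2
  unfold frame
  rw [mfderiv_eq_of_eqOn hu hp]
  exact DFunLike.congr_fun (ContinuousLinearMap.inverse_eq (R := ℂ) (M := Cn m) (M₂ := Cn m) h2 h1)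
    (Pi.single i 1 : Cn m)

theorem exists_frame_basis {ψ : OpenPartialHomeomorph M (Cn m)} (hψ : IsHolChart ψ)
    {u : M → Cn m} (hu : Set.EqOn ψ u ψ.source) {p : M} (hp : p ∈ ψ.source) :
    ∃ b : Module.Basis (Fin m) ℂ (TangentSpace 𝓘(ℂ, Cn m) p), ∀ i, b i = frame u i p := by
  have h1 := hψ.mdifferentiable.symm_comp_deriv hp
  have h2 := hψ.mdifferentiable.comp_symm_deriv (ψ.map_source hp)
  rw [ψ.left_inv hp] at h2
  let e : Cn m ≃ₗ[ℂ] TangentSpace 𝓘(ℂ, Cn m) p :=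
    { toLinearMap := (mfderiv 𝓘(ℂ, Cn m) 𝓘(ℂ, Cn m) ψ.symm (ψ p) : Cn m →L[ℂ] Cn m).toLinearMap
      invFun := mfderiv 𝓘(ℂ, Cn m) 𝓘(ℂ, Cn m) ψ p
      left_inv := fun v => DFunLike.congr_fun h2 v
      right_inv := fun v => DFunLike.congr_fun h1 v }
  refine ⟨(Pi.basisFun ℂ (Fin m)).map e, fun i => ?_⟩
  rw [frame_eq hψ hu hp, Module.Basis.map_apply, Pi.basisFun_apply]
  rfl

/-- Expresses the frame through the transition map from canonical coordinates, which is what makes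
its regularity visible. -/
theorem locFrame_eq (hφ : IsHolChart φ) {ψ : OpenPartialHomeomorph M (Cn m)} (hψ : IsHolChart ψ)
    {u : M → Cn m} (hu : Set.EqOn ψ u ψ.source) {x : Cn m} (hx : x ∈ φ.target)
    (hxψ : φ.symm x ∈ ψ.source) (i : Fin m) :
    locFrame φ u i x = fderiv ℂ (φ ∘ ψ.symm) (ψ (φ.symm x)) (Pi.single i 1) := by
  have hd1 : MDifferentiableAt 𝓘(ℂ, Cn m) 𝓘(ℂ, Cn m) φ (ψ.symm (ψ (φ.symm x))) := by
    rw [ψ.left_inv hxψ]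
    exact hφ.mdifferentiable.mdifferentiableAt (φ.map_target hx)
  have hd2 : MDifferentiableAt 𝓘(ℂ, Cn m) 𝓘(ℂ, Cn m) ψ.symm (ψ (φ.symm x)) :=
    hψ.mdifferentiable.mdifferentiableAt_symm (ψ.map_source hxψ)
  have h := mfderiv_comp (ψ (φ.symm x)) hd1 hd2
  rw [ψ.left_inv hxψ, mfderiv_eq_fderiv] at h
  unfold locFrame compL
  rw [frame_eq hψ hu hxψ]
  exact (DFunLike.congr_fun h (Pi.single i 1 : Cn m)).symm

/-- Regularity over `ℂ` serves twice: it gives `∂̄ e_i = 0` and, by restriction of scalars, admits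
`e_i` as a smooth test field. -/
theorem contDiffOn_locFrame (hφ : IsHolChart φ) {u : M → Cn m}
    (hu : ∀ p : M, ∃ ψ : OpenPartialHomeomorph M (Cn m),
      IsHolChart ψ ∧ p ∈ ψ.source ∧ Set.EqOn ψ u ψ.source) (i : Fin m) :
    ContDiffOn ℂ ω (locFrame φ u i) φ.target := by
  intro x hx
  obtain ⟨ψ, hψ, hp, hψu⟩ := hu (φ.symm x)
  apply ContDiffAt.contDiffWithinAt
  have h1 : ContDiffAt ℂ ω (ψ ∘ φ.symm) x :=
    ((contMDiffAt_of_mem_maximalAtlas hψ hp).comp x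
      (contMDiffAt_symm_of_mem_maximalAtlas hφ hx)).contDiffAt
  have h2 : ContDiffAt ℂ ω (φ ∘ ψ.symm) (ψ (φ.symm x)) := by
    refine (ContMDiffAt.comp (I' := 𝓘(ℂ, Cn m)) (ψ (φ.symm x)) ?_
      (contMDiffAt_symm_of_mem_maximalAtlas hψ (ψ.map_source hp))).contDiffAt
    rw [ψ.left_inv hp]
    exact contMDiffAt_of_mem_maximalAtlas hφ (φ.map_target hx)
  have h3 : ContDiffAt ℂ ω (fderiv ℂ (φ ∘ ψ.symm)) (ψ (φ.symm x)) :=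
    h2.fderiv_right (by simp)
  have h4 : ContDiffAt ℂ ω
      (fun y => fderiv ℂ (φ ∘ ψ.symm) (ψ (φ.symm y)) (Pi.single i 1)) x :=
    (h3.comp x h1).clm_apply contDiffAt_const
  refine h4.congr_of_eventuallyEq ?_
  filter_upwards [φ.open_target.mem_nhds hx,
    (φ.continuousAt_symm hx).preimage_mem_nhds (ψ.open_source.mem_nhds hp)] with y hy hyψ
  exact locFrame_eq hφ hψ hψu hy hyψ i

end Charts

/-! ### Local operators -/

section Calculus

variable {m : ℕ}

theorem wirt_congr (a : Fin m) {f f' : Cn m → ℂ} {x : Cn m} (h : f =ᶠ[nhds x] f') :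
    wirt a f x = wirt a f' x := by
  unfold wirt
  rw [h.fderiv_eq]

theorem wirt_zero (a : Fin m) (x : Cn m) : wirt a (fun _ => 0) x = 0 := by
  simp [wirt]

theorem wirtBar_of_differentiableAt (a : Fin m) {f : Cn m → ℂ} {x : Cn m}
    (hf : DifferentiableAt ℂ f x) : wirtBar a f x = 0 := by
  have hI : (Pi.single a Complex.I : Cn m) = Complex.I • (Pi.single a (1 : ℂ) : Cn m) := by
    ext j
    by_cases h : j = a
    · subst h; simp
    · simp [h]
  unfold wirtBar
  rw [hf.fderiv_restrictScalars ℝ, ContinuousLinearMap.coe_restrictScalars', hI, map_smul,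
    smul_eq_mul, ← mul_assoc, Complex.I_mul_I]
  ring

theorem dbar_of_differentiableAt (a : Fin m) {Y : Cn m → Cn m} {x : Cn m}
    (hY : DifferentiableAt ℂ Y x) : dbar a Y x = 0 := by
  ext k
  exact wirtBar_of_differentiableAt a (differentiableAt_pi.1 hY k)

theorem lieBr_congr_right (X : Cn m → Cn m) {Y Y' : Cn m → Cn m} {x : Cn m}
    (h : Y =ᶠ[nhds x] Y') : lieBr X Y x = lieBr X Y' x := by
  ext k
  have hk : (fun y => Y y k) =ᶠ[nhds x] fun y => Y' y k := by
    filter_upwards [h] with y hy using by rw [hy]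
  simp only [lieBr, dirDeriv, wirt_congr _ hk, h.eq_of_nhds]

theorem covDeriv_eq_zero (Γ : Fin m → Fin m → Fin m → Cn m → ℂ) (a : Fin m) {Y : Cn m → Cn m}
    {x : Cn m} (h : Y =ᶠ[nhds x] 0) : covDeriv Γ a Y x = 0 := by
  ext k
  have hk : (fun y => Y y k) =ᶠ[nhds x] fun _ => 0 := by
    filter_upwards [h] with y hy using by rw [hy]; rfl
  simp [covDeriv, wirt_congr _ hk, wirt_zero, h.eq_of_nhds]

end Calculus

/-! ### Translation of the operators in a chart into tangent-space algebra -/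

section Coordinates

variable {m : ℕ} {M : Type*} [TopologicalSpace M] [ChartedSpace (Cn m) M]
  [IsManifold 𝓘(ℂ, Cn m) ω M] {φ : OpenPartialHomeomorph M (Cn m)}

theorem eq_of_vecL_eq (hφ : IsHolChart φ) {x : Cn m} (hx : x ∈ φ.target) {v w : Cn m}
    (h : vecL φ x v = vecL φ x w) : v = w := by
  rw [← compL_vecL hφ hx v, h, compL_vecL hφ hx]

theorem vecL_locFrame (hφ : IsHolChart φ) {x : Cn m} (hx : x ∈ φ.target) (u : M → Cn m)
    (i : Fin m) : vecL φ x (locFrame φ u i x) = frame u i (φ.symm x) :=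
  vecL_compL hφ hx _

/-- The coordinate basis of the tangent space. -/
noncomputable def coordBasis (hφ : IsHolChart φ) {x : Cn m} (hx : x ∈ φ.target) :
    Module.Basis (Fin m) ℂ (TangentSpace 𝓘(ℂ, Cn m) (φ.symm x)) :=
  (Pi.basisFun ℂ (Fin m)).map
    { toLinearMap := (vecL φ x).toLinearMap
      invFun := compL φ x
      left_inv := compL_vecL hφ hx
      right_inv := vecL_compL hφ hx }

theorem coordBasis_apply (hφ : IsHolChart φ) {x : Cn m} (hx : x ∈ φ.target) (a : Fin m) :
    coordBasis hφ hx a = vecL φ x (coordField a x) := by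
  rw [coordBasis, Module.Basis.map_apply, Pi.basisFun_apply]
  rfl

variable {F : FrobeniusData m M} {S : CDVData m M}

theorem vecL_locMul (hφ : IsHolChart φ) {x : Cn m} (hx : x ∈ φ.target) (Y Z : Cn m → Cn m) :
    vecL φ x (F.locMul φ Y Z x) = F.mul (φ.symm x) (vecL φ x (Y x)) (vecL φ x (Z x)) :=
  vecL_compL hφ hx _

theorem vecL_locE (hφ : IsHolChart φ) {x : Cn m} (hx : x ∈ φ.target) :
    vecL φ x (F.locE φ x) = F.E (φ.symm x) :=
  vecL_compL hφ hx _

theorem vecL_locK (hφ : IsHolChart φ) {x : Cn m} (hx : x ∈ φ.target) (Y : Cn m → Cn m) :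
    vecL φ x (S.locK φ Y x) = S.κ (φ.symm x) (vecL φ x (Y x)) :=
  vecL_compL hφ hx _

theorem vecL_higgs (hφ : IsHolChart φ) {x : Cn m} (hx : x ∈ φ.target) (a : Fin m)
    (Y : Cn m → Cn m) :
    vecL φ x (S.higgs φ a Y x)
      = - S.mul (φ.symm x) (vecL φ x (coordField a x)) (vecL φ x (Y x)) := by
  rw [CDVData.higgs, map_neg, vecL_locMul hφ hx]

theorem vecL_higgsDag (hφ : IsHolChart φ) {x : Cn m} (hx : x ∈ φ.target) (a : Fin m)
    (Y : Cn m → Cn m) :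
    vecL φ x (S.higgsDag φ a Y x) = - S.κ (φ.symm x)
      (S.mul (φ.symm x) (vecL φ x (coordField a x)) (S.κ (φ.symm x) (vecL φ x (Y x)))) := by
  rw [CDVData.higgsDag, vecL_locK hφ hx, vecL_higgs hφ hx, vecL_locK hφ hx, map_neg]

theorem vecL_opUDag (hφ : IsHolChart φ) {x : Cn m} (hx : x ∈ φ.target) (Y : Cn m → Cn m) :
    vecL φ x (S.opUDag φ Y x) = S.κ (φ.symm x)
      (S.mul (φ.symm x) (S.E (φ.symm x)) (S.κ (φ.symm x) (vecL φ x (Y x)))) := by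
  rw [CDVData.opUDag, vecL_locK hφ hx, CDVData.opU, vecL_locMul hφ hx, vecL_locE hφ hx,
    vecL_locK hφ hx]

theorem higgs_commutator_eq_zero_iff (hφ : IsHolChart φ) {x : Cn m} (hx : x ∈ φ.target)
    (a b : Fin m) (Y : Cn m → Cn m) :
    S.higgs φ a (S.higgsDag φ b Y) x - S.higgsDag φ b (S.higgs φ a Y) x = 0 ↔
      S.mul (φ.symm x) (vecL φ x (coordField a x)) (S.κ (φ.symm x)
        (S.mul (φ.symm x) (vecL φ x (coordField b x)) (S.κ (φ.symm x) (vecL φ x (Y x))))) =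
      S.κ (φ.symm x) (S.mul (φ.symm x) (vecL φ x (coordField b x)) (S.κ (φ.symm x)
        (S.mul (φ.symm x) (vecL φ x (coordField a x)) (vecL φ x (Y x))))) := by
  have h1 : vecL φ x (S.higgs φ a (S.higgsDag φ b Y) x) = S.mul (φ.symm x)
      (vecL φ x (coordField a x)) (S.κ (φ.symm x) (S.mul (φ.symm x) (vecL φ x (coordField b x))
        (S.κ (φ.symm x) (vecL φ x (Y x))))) := by
    rw [vecL_higgs hφ hx, vecL_higgsDag hφ hx, map_neg, neg_neg]
  have h2 : vecL φ x (S.higgsDag φ b (S.higgs φ a Y) x) = S.κ (φ.symm x) (S.mul (φ.symm x)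
      (vecL φ x (coordField b x)) (S.κ (φ.symm x) (S.mul (φ.symm x) (vecL φ x (coordField a x))
        (vecL φ x (Y x))))) := by
    rw [vecL_higgsDag hφ hx, vecL_higgs hφ hx, map_neg, map_neg, map_neg, neg_neg]
  rw [sub_eq_zero, ← h1, ← h2]
  exact ⟨fun h => by rw [h], eq_of_vecL_eq hφ hx⟩

end Coordinates

/-! ### Each condition is equivalent to diagonality of `κ` -/

section Equivalence

variable {m : ℕ} {M : Type*} [TopologicalSpace M] [ChartedSpace (Cn m) M]
  {S : CDVData m M} {u : M → Cn m}

/-- The real structure maps each canonical vector field to a multiple of itself. -/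
def KappaDiagonal (S : CDVData m M) (u : M → Cn m) : Prop :=
  ∀ (p : M) (b : Module.Basis (Fin m) ℂ (TangentSpace 𝓘(ℂ, Cn m) p)),
    (∀ i, b i = frame u i p) → IsDiagIn (S.κ p) b

theorem IsCanonical.mul_basis {F : FrobeniusData m M} (hu : IsCanonical F u) {p : M}
    {b : Module.Basis (Fin m) ℂ (TangentSpace 𝓘(ℂ, Cn m) p)} (hb : ∀ i, b i = frame u i p)
    (i j : Fin m) : F.mul p (b i) (b j) = if i = j then b i else 0 := by
  rw [hb, hb]
  exact hu.mul_frame p i j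

variable [IsManifold 𝓘(ℂ, Cn m) ω M]

theorem IsCanonical.exists_basis {F : FrobeniusData m M} (hu : IsCanonical F u) (p : M) :
    ∃ b : Module.Basis (Fin m) ℂ (TangentSpace 𝓘(ℂ, Cn m) p), ∀ i, b i = frame u i p := by
  obtain ⟨ψ, hψ, hp, hψu⟩ := hu.etale p
  exact exists_frame_basis hψ hψu hp

theorem gram_iff_kappaDiagonal (hS : S.IsCDVPos) (hu : IsCanonical S.toFrobeniusData u)
    {η : M → ℂ} (hη : IsMetricPotential S.toFrobeniusData u η) :
    (∀ p : M, (Matrix.of fun i j => S.h p (frame u i p) (frame u j p)) =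
      Matrix.diagonal fun i => ((‖potDeriv u η i p‖ : ℝ) : ℂ)) ↔ KappaDiagonal S u := by
  have key : ∀ (p : M) (b : Module.Basis (Fin m) ℂ (TangentSpace 𝓘(ℂ, Cn m) p)),
      (∀ i, b i = frame u i p) → (IsDiagIn (S.κ p) b ↔
      (Matrix.of fun i j => S.h p (frame u i p) (frame u j p)) =
        Matrix.diagonal fun i => ((‖potDeriv u η i p‖ : ℝ) : ℂ)) := by
    intro p b hb
    have h := isDiagIn_iff_gram (hu.mul_basis hb) (hS.frobenius.g_mul p) (hS.frobenius.g_nondeg p)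
      (hS.κ_invol p) (hS.h_herm p) (hS.h_pos p)
    simp only [hb] at h
    simp only [hη.deriv_eq]
    exact h
  constructor
  · intro h p b hb
    exact (key p b hb).2 (h p)
  · intro h p
    obtain ⟨b, hb⟩ := hu.exists_basis p
    exact (key p b hb).1 (h p b hb)

theorem KappaDiagonal.chernHolomorphic (hκ : KappaDiagonal S u) (hS : S.IsCDVPos)
    (hu : IsCanonical S.toFrobeniusData u) : S.ChernHolomorphic := by
  intro φ hφ a c Y hY x hx
  have h := hS.ttstar φ hφ a c Y hY x hx
  obtain ⟨b, hb⟩ := hu.exists_basis (φ.symm x)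
  rwa [(higgs_commutator_eq_zero_iff hφ hx a c Y).2
    ((hκ _ b hb).commute (hu.mul_basis hb) _ _ _), add_zero] at h

theorem CDVData.ChernHolomorphic.kappaDiagonal (hD : S.ChernHolomorphic) (hS : S.IsCDVPos)
    (hu : IsCanonical S.toFrobeniusData u) : KappaDiagonal S u := by
  intro p b hb
  obtain ⟨φ, hφ, hp, -⟩ := hu.etale p
  obtain ⟨x, hx, rfl⟩ : ∃ x ∈ φ.target, φ.symm x = p := ⟨φ p, φ.map_source hp, φ.left_inv hp⟩
  refine isDiagIn_of_commute (hu.mul_basis hb) (hS.frobenius.g_mul _) (hS.h_pos _) ?_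
  have h : ∀ a c y, S.mul (φ.symm x) (coordBasis hφ hx a) (S.κ (φ.symm x)
      (S.mul (φ.symm x) (coordBasis hφ hx c) (S.κ (φ.symm x) y))) = S.κ (φ.symm x)
      (S.mul (φ.symm x) (coordBasis hφ hx c) (S.κ (φ.symm x)
      (S.mul (φ.symm x) (coordBasis hφ hx a) y))) := by
    intro a c y
    -- The commutator is pointwise, so any smooth extension of `y` will do; a constant one is
    -- chosen.
    have hY : SmoothField φ fun _ => compL φ x y := contDiffOn_const
    have h1 := hS.ttstar φ hφ a c _ hY x hx
    rw [hD φ hφ a c _ hY x hx, zero_add, higgs_commutator_eq_zero_iff hφ hx,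
      vecL_compL hφ hx] at h1
    simpa only [coordBasis_apply] using h1
  intro v w y
  -- Both sides are linear in `v` and antilinear in `w`, so coordinate vectors suffice.
  rw [← (coordBasis hφ hx).sum_repr v, ← (coordBasis hφ hx).sum_repr w]
  simp only [map_sum, map_smul, LinearMap.map_smulₛₗ, LinearMap.sum_apply, LinearMap.smul_apply, h,
    Complex.conj_conj, Finset.smul_sum]
  exact Finset.sum_comm.trans (Finset.sum_congr rfl fun i _ =>
    Finset.sum_congr rfl fun j _ => smul_comm _ _ _)

theorem CDVData.IndexVanishes.kappaDiagonal (hQ : S.IndexVanishes) (hS : S.IsCDVPos)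
    (hss : S.toFrobeniusData.IsSemisimple)
    (hu : IsCanonical S.toFrobeniusData u) : KappaDiagonal S u := by
  intro p b hb
  obtain ⟨φ, hφ, hp, -⟩ := hu.etale p
  obtain ⟨x, hx, rfl⟩ : ∃ x ∈ φ.target, φ.symm x = p := ⟨φ p, φ.map_source hp, φ.left_inv hp⟩
  obtain ⟨μ, hμ, hev⟩ := hss (φ.symm x)
  refine isDiagIn_of_commute_element (hu.mul_basis hb) (hS.frobenius.g_mul _) (hS.h_pos _)
    (hS.κ_invol _) (repr_injective_of_eigenvalues (hu.mul_basis hb) hμ hev) ?_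
  have h : ∀ a y, S.mul (φ.symm x) (coordBasis hφ hx a) (S.κ (φ.symm x)
      (S.mul (φ.symm x) (S.E (φ.symm x)) (S.κ (φ.symm x) y))) = S.κ (φ.symm x)
      (S.mul (φ.symm x) (S.E (φ.symm x)) (S.κ (φ.symm x)
      (S.mul (φ.symm x) (coordBasis hφ hx a) y))) := by
    intro a y
    -- The test field `κ c` takes the value `y` at `x` and satisfies `D'(κ c) = κ ∂̄c = 0`. Thus
    -- `D'` of it is visibly smooth, as needed to apply `Q = 0` to it.
    set c : Cn m → Cn m := fun _ => compL φ x (S.κ (φ.symm x) y)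
    have hc : SmoothField φ c := contDiffOn_const
    have hY : SmoothField φ (S.locK φ c) := hS.κ_smooth φ hφ c hc
    have hDY : ∀ z ∈ φ.target, S.chernD φ a (S.locK φ c) z = 0 := by
      intro z hz
      rw [hS.dκ φ hφ a c hc z hz]
      refine eq_of_vecL_eq hφ hz ?_
      rw [vecL_locK hφ hz, dbar_of_differentiableAt a (differentiableAt_const _), map_zero,
        map_zero]
    have hDYs : SmoothField φ (S.chernD φ a (S.locK φ c)) :=
      (contDiffOn_const (c := (0 : Cn m))).congr hDY
    have hDQ : S.chernD φ a (S.opQ φ (S.locK φ c)) x = 0 := by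
      refine covDeriv_eq_zero _ a ?_
      filter_upwards [φ.open_target.mem_nhds hx] with z hz using hQ φ hφ _ hY z hz
    have h1 := hS.dQ φ hφ a _ hY x hx
    rw [hDQ, hQ φ hφ _ hDYs x hx, sub_zero, zero_add, sub_eq_zero] at h1
    have h2 := congrArg (vecL φ x) h1
    rw [vecL_higgs hφ hx, vecL_opUDag hφ hx, vecL_opUDag hφ hx, vecL_higgs hφ hx,
      vecL_locK hφ hx, vecL_compL hφ hx, hS.κ_invol, map_neg, map_neg, map_neg, neg_inj] at h2
    simpa only [coordBasis_apply, hS.κ_invol] using h2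
  intro v y
  rw [← (coordBasis hφ hx).sum_repr v]
  simp only [map_sum, map_smul, LinearMap.map_smulₛₗ, LinearMap.sum_apply, LinearMap.smul_apply, h,
    Complex.conj_conj]

/-- The canonical vector fields are eigenvectors of `L_E`. -/
theorem lieBr_locFrame_mem_span (hF : S.toFrobeniusData.IsFrobenius)
    (hu : IsCanonical S.toFrobeniusData u) {φ : OpenPartialHomeomorph M (Cn m)}
    (hφ : IsHolChart φ) {x : Cn m} (hx : x ∈ φ.target) (i : Fin m) :
    vecL φ x (lieBr (S.locE φ) (locFrame φ u i) x)
      ∈ Submodule.span ℂ {frame u i (φ.symm x)} := by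
  obtain ⟨b, hb⟩ := hu.exists_basis (φ.symm x)
  have hhol : HolField φ (locFrame φ u i) :=
    (contDiffOn_locFrame hφ hu.etale i).differentiableOn (by simp)
  have hsq : ∀ z ∈ φ.target, S.locMul φ (locFrame φ u i) (locFrame φ u i) z = locFrame φ u i z := by
    intro z hz
    refine eq_of_vecL_eq hφ hz ?_
    rw [vecL_locMul hφ hz, vecL_locFrame hφ hz, hu.mul_frame, if_pos rfl]
  -- Applying `L_E(∘) = ∘` to `e_i ∘ e_i = e_i` gives `L_E e_i = e_i + 2 e_i ∘ L_E e_i`, and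
  -- multiplication by `e_i` lands in `ℂ e_i`.
  have h := hF.lie_mul φ hφ _ _ hhol hhol x hx
  rw [lieBr_congr_right _ (Filter.eventuallyEq_of_mem (φ.open_target.mem_nhds hx) hsq),
    hsq x hx] at h
  have h1 := congrArg (vecL φ x) h
  rw [map_sub, map_sub, vecL_locMul hφ hx, vecL_locMul hφ hx, vecL_locFrame hφ hx,
    hF.mul_comm _ _ (frame u i _), ← hb, mul_idempotent (hu.mul_basis hb)] at h1
  rw [sub_eq_iff_eq_add, sub_eq_iff_eq_add] at h1
  rw [h1, ← hb]
  have hm := Submodule.mem_span_singleton_self (R := ℂ) (b i)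
  exact add_mem (add_mem hm (Submodule.smul_mem _ _ hm)) (Submodule.smul_mem _ _ hm)

/-- The canonical vector fields are eigenvectors of `D'` when `κ` is diagonal. -/
theorem KappaDiagonal.chernD_locFrame_mem_span (hκ : KappaDiagonal S u) (hS : S.IsCDVPos)
    (hu : IsCanonical S.toFrobeniusData u) {φ : OpenPartialHomeomorph M (Cn m)}
    (hφ : IsHolChart φ) {x : Cn m} (hx : x ∈ φ.target) (a i : Fin m) :
    vecL φ x (S.chernD φ a (locFrame φ u i) x) ∈ Submodule.span ℂ {frame u i (φ.symm x)} := by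
  obtain ⟨b, hb⟩ := hu.exists_basis (φ.symm x)
  have hsm : ∀ j, SmoothField φ (locFrame φ u j) := fun j =>
    ((contDiffOn_locFrame hφ hu.etale j).of_le le_top).restrict_scalars ℝ
  have hzero : ∀ j, j ≠ i → b.repr (vecL φ x (S.chernD φ a (locFrame φ u i) x)) j = 0 := by
    intro j hj
    -- Differentiate `g(e_i, κ e_j) = 0`, valid near `x` for `j ≠ i`. Since `D'(κ e_j) = κ ∂̄e_j =
    -- 0`, only `g(D'e_i, κ e_j) = 0` remains, which kills the `j`-th component of `D'e_i`.
    have h := hS.dg φ hφ a _ _ (hsm i) (hS.κ_smooth φ hφ _ (hsm j)) x hx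
    have h0 : S.locG φ (locFrame φ u i) (S.locK φ (locFrame φ u j)) =ᶠ[nhds x] fun _ => 0 := by
      filter_upwards [φ.open_target.mem_nhds hx] with z hz
      obtain ⟨b', hb'⟩ := hu.exists_basis (φ.symm z)
      change S.g _ (vecL φ z _) (vecL φ z _) = 0
      rw [vecL_locK hφ hz, vecL_locFrame hφ hz, vecL_locFrame hφ hz, ← hb', ← hb', hκ _ b' hb' j,
        map_smul, metric_idempotents (hu.mul_basis hb') (hS.frobenius.g_mul _) (Ne.symm hj),
        smul_zero]
    have hdK : S.chernD φ a (S.locK φ (locFrame φ u j)) x = 0 := by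
      rw [hS.dκ φ hφ a _ (hsm j) x hx]
      refine eq_of_vecL_eq hφ hx ?_
      rw [vecL_locK hφ hx, dbar_of_differentiableAt a
        (((contDiffOn_locFrame hφ hu.etale j).contDiffAt
          (φ.open_target.mem_nhds hx)).differentiableAt (by simp)), map_zero, map_zero]
    rw [wirt_congr a h0, wirt_zero] at h
    change 0 = S.g _ (vecL φ x _) (vecL φ x _) + S.g _ (vecL φ x _) (vecL φ x _) at h
    rw [hdK, map_zero, map_zero, add_zero, vecL_locK hφ hx, vecL_locFrame hφ hx, ← hb,
      hκ _ b hb j, map_smul, hS.frobenius.g_symm,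
      metric_idempotent_left (hu.mul_basis hb) (hS.frobenius.g_mul _), smul_eq_mul] at h
    exact ((mul_eq_zero.1 ((mul_eq_zero.1 h.symm).resolve_left
      ((hκ _ b hb).ne_zero (hS.κ_invol _) j))).resolve_right
      (metric_idempotent_ne_zero (hu.mul_basis hb) (hS.frobenius.g_mul _)
        (hS.frobenius.g_nondeg _) j))
  rw [← hb, Submodule.mem_span_singleton]
  refine ⟨b.repr (vecL φ x (S.chernD φ a (locFrame φ u i) x)) i, b.ext_elem fun j => ?_⟩
  by_cases hj : j = i
  · subst hj; simp
  · simp [hzero j hj, Finsupp.single_eq_of_ne hj]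

theorem KappaDiagonal.indexVanishes (hκ : KappaDiagonal S u) (hS : S.IsCDVPos)
    (hu : IsCanonical S.toFrobeniusData u) : S.IndexVanishes := by
  intro φ hφ Y hY x hx
  obtain ⟨b, hb⟩ := hu.exists_basis (φ.symm x)
  have hsm : ∀ j, SmoothField φ (locFrame φ u j) := fun j =>
    ((contDiffOn_locFrame hφ hu.etale j).of_le le_top).restrict_scalars ℝ
  have hframe : ∀ i, vecL φ x (S.opQ φ (locFrame φ u i) x) = 0 := by
    intro i
    have hmem : vecL φ x (S.opQ φ (locFrame φ u i) x)
        ∈ Submodule.span ℂ {frame u i (φ.symm x)} := by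
      simp only [CDVData.opQ, CDVData.chernE, map_sub, map_sum, map_smul]
      refine sub_mem (sub_mem (sum_mem fun a _ => Submodule.smul_mem _ _
        (hκ.chernD_locFrame_mem_span hS hu hφ hx a i))
        (lieBr_locFrame_mem_span hS.frobenius hu hφ hx i)) (Submodule.smul_mem _ _ ?_)
      rw [vecL_locFrame hφ hx]
      exact Submodule.mem_span_singleton_self _
    obtain ⟨q, hq⟩ := Submodule.mem_span_singleton.1 hmem
    have h := hS.Q_g φ hφ _ _ (hsm i) (hsm i) x hx
    change S.g _ (vecL φ x _) (vecL φ x _) = - S.g _ (vecL φ x _) (vecL φ x _) at h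
    rw [vecL_locFrame hφ hx, hS.frobenius.g_symm, self_eq_neg, ← hq, map_smul, ← hb,
      smul_eq_mul] at h
    rw [← hq, (mul_eq_zero.1 h).resolve_right (metric_idempotent_ne_zero (hu.mul_basis hb)
      (hS.frobenius.g_mul _) (hS.frobenius.g_nondeg _) i), zero_smul]
  -- For general `Y`, linearity of `Q` over functions is bypassed: `g(QY, e_j) = -g(Y, Q e_j) = 0`
  -- for all `j`, and `g` is nondegenerate.
  refine eq_of_vecL_eq hφ hx ?_
  rw [map_zero]
  refine hS.frobenius.g_nondeg _ _ fun w => ?_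
  rw [← b.sum_repr w, map_sum]
  refine Finset.sum_eq_zero fun j _ => ?_
  have h := hS.Q_g φ hφ _ _ hY (hsm j) x hx
  change S.g _ (vecL φ x _) (vecL φ x _) = - S.g _ (vecL φ x _) (vecL φ x _) at h
  rw [hframe, map_zero, neg_zero, vecL_locFrame hφ hx, ← hb] at h
  rw [map_smul, h, smul_zero]

end Equivalence

end TTStar

theorem proposition1p1 {m : ℕ} {M : Type*} [TopologicalSpace M]
    [ChartedSpace (TTStar.Cn m) M] [IsManifold 𝓘(ℂ, TTStar.Cn m) ω M]
    (S : TTStar.CDVData m M) (hS : S.IsCDVPos) (hss : S.toFrobeniusData.IsSemisimple)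
    (u : M → TTStar.Cn m) (hu : TTStar.IsCanonical S.toFrobeniusData u)
    (η : M → ℂ) (hη : TTStar.IsMetricPotential S.toFrobeniusData u η) :
    List.TFAE [
      (∀ p : M, (Matrix.of fun i j => S.h p (TTStar.frame u i p) (TTStar.frame u j p)) =
        Matrix.diagonal fun i => ((‖TTStar.potDeriv u η i p‖ : ℝ) : ℂ)),
      S.ChernHolomorphic,
      S.IndexVanishes] := by
  rw [TTStar.gram_iff_kappaDiagonal hS hu hη]
  tfae_have 1 → 2 := fun h => h.chernHolomorphic hS hu
  tfae_have 2 → 1 := fun h => h.kappaDiagonal hS hu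
  tfae_have 1 → 3 := fun h => h.indexVanishes hS hu
  tfae_have 3 → 1 := fun h => h.kappaDiagonal hS hss hu
  tfae_finish
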